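/- Let $N\ge 1$ and let $W(z)$ be an $N\times N$ complex matrix function on $\mathbb C\setminus\{0\}$ of Fuchsian type, i.e. given by a Laurent series convergent on $\mathbb C\setminus\{0\}$ $$W(z)=W_{-1}z^{-1}+W_0+W_1z+W_2z^2+\cdots,\qquad W_{-1}\neq 0$$ (for example $W(z)=W_{-1}z^{-1}+W_0+W_1z$). Let $S$ be a fundamental solution on $\mathbb C\setminus\{0\}$, possibly multivalued, of the Pearson system $$\frac{\mathrm d w(z)}{\mathrm d z}=W(z)\,w(z),$$ that is, an analytic function of $t=\log z\in\mathbb C$ with values in $\mathrm{GL}(N,\mathbb C)$ satisfying $\frac{\mathrm dS}{\mathrm dt}=e^tW(e^t)S$. Let the matrix of weights $w:\mathbb T\to\mathbb C^{N\times N}$ on the unit circle be given by a branch of $S$: for some $\theta_0\in\mathbb R$, $w(e^{\mathrm i\theta})=S(\mathrm i\theta)$ for all $\theta_0<\theta<\theta_0+2\pi$. If $w$ is Hölder, i.e. each of its entries satisfies $|w_{ij}(\zeta_1)-w_{ij}(\zeta_2)|\le M|\zeta_1-\zeta_2|^{\alpha}$ on $\mathbb T$ for some $M>0$ and $0<\alpha\le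 1$, then $W_{-1}$ is diagonalizable with integer eigenvalues: $W_{-1}=P\,\mathrm{diag}(\lambda_1,\dots,\lambda_N)\,P^{-1}$ with $P\in\mathrm{GL}(N,\mathbb C)$ and $\lambda_1,\dots,\lambda_N\in\mathbb Z$. -/

import Mathlib

/-- `W` is of Fuchsian type with coefficient `R = W₋₁`: on the punctured plane it is the sum of a
convergent Laurent series `W(z) = R z⁻¹ + W₀ + W₁ z + ⋯` with `R ≠ 0`. -/
def IsFuchsian {N : ℕ} (W : ℂ → Matrix (Fin N) (Fin N) ℂ) (R : Matrix (Fin N) (Fin N) ℂ) : Prop :=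
  R ≠ 0 ∧ ∃ A : ℕ → Matrix (Fin N) (Fin N) ℂ,
    ∀ z : ℂ, z ≠ 0 → HasSum (fun k : ℕ => z ^ k • A k) (W z - z⁻¹ • R)

/-- A (possibly multivalued) fundamental solution of the Pearson system `dw/dz = W(z) w(z)` on the
punctured plane. A multivalued function of `z ≠ 0` is a function `S` of `t = log z ∈ ℂ`, that is,
a function on the universal cover `exp : ℂ → ℂ \ {0}`. Since `dz = z dt`, the system reads
`dS/dt = z W(z) S` with `z = exp t`; the values of `S` are required to be invertible. -/
def IsFundamentalSolution {N : ℕ} (W S : ℂ → Matrix (Fin N) (Fin N) ℂ) : Prop :=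
  (∀ t : ℂ, ∀ i j : Fin N,
    HasDerivAt (fun s : ℂ => S s i j)
      ((Complex.exp t • (W (Complex.exp t) * S t)) i j) t) ∧
  ∀ t : ℂ, IsUnit (S t)

/-- The function `w` on the unit circle is given by a branch of the multivalued function `S`,
with the cut at some point `exp (i θ₀)`, at which nothing is required. -/
def IsBranchOnCircle {N : ℕ} (w : Circle → Matrix (Fin N) (Fin N) ℂ)
    (S : ℂ → Matrix (Fin N) (Fin N) ℂ) : Prop :=
  ∃ θ₀ : ℝ, ∀ θ ∈ Set.Ioo θ₀ (θ₀ + 2 * Real.pi), w (Circle.exp θ) = S (θ * Complex.I)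

/-- Every entry of the matrix function `w` on the unit circle is Hölder, with some exponent
`0 < α ≤ 1` (the distance of the circle being that of `ℂ`). -/
def IsHolderMatrix {N : ℕ} (w : Circle → Matrix (Fin N) (Fin N) ℂ) : Prop :=
  ∀ i j : Fin N, ∃ (M α : NNReal), 0 < α ∧ α ≤ 1 ∧ HolderWith M α (fun ζ : Circle => w ζ i j)

/-- `R` is diagonalizable over `ℂ` with all its eigenvalues integers: `R = P Λ P⁻¹`,
`Λ = diag(l₁, …, l_N)`, `l_i ∈ ℤ`, `P ∈ GL(N, ℂ)`. -/
def IsDiagonalizableWithIntegerEigenvalues {N : ℕ} (R : Matrix (Fin N) (Fin N) ℂ) : Prop :=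
  ∃ (P : GL (Fin N) ℂ) (l : Fin N → ℤ),
    R = (P : Matrix (Fin N) (Fin N) ℂ) * Matrix.diagonal (fun i => (l i : ℂ)) *
      ((P⁻¹ : GL (Fin N) ℂ) : Matrix (Fin N) (Fin N) ℂ)

/-! A Hölder weight is continuous, so `S` agrees at the two ends of the cut; uniqueness for linear
systems then makes `S` periodic under `2πi`, that is, the monodromy is trivial. With `B(z) = z
W(z)`, an entire function with `B(0) = R`, Gronwall bounds `S` and its inverse by a power of `1/|z|`
near `0`. Hence `U = z^m S` and `H = z^m S⁻¹` are entire in `z` for some `m`, and `U H = z^(2m)`.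

Diagonalizability comes without any normal form. From `z H' = H (m - B)` one gets `z^n H⁽ⁿ⁾ = H F`
with `F(0) = ∏_{k<n} (m - k - R)` (`exists_pow_smul_iteratedDeriv_eq_mul`). For `n = 2m + 1`,
multiplying by `U` gives `F = z U H⁽ⁿ⁾`, so `F(0) = 0`: `R` is a root of a polynomial with simple
integer roots. -/

/-! ### Entire functions of `z` and periodic functions of `log z`. -/

/-- A vector-valued power series converging at every nonzero point has an entire sum. -/
theorem differentiable_tsum_pow_smul {E : Type*} [NormedAddCommGroup E] [NormedSpace ℂ E]
    [CompleteSpace E] {A : ℕ → E} (hA : ∀ z : ℂ, z ≠ 0 → Summable fun k : ℕ => z ^ k • A k) :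
    Differentiable ℂ fun z : ℂ => ∑' k : ℕ, z ^ k • A k := by
  intro z₀
  set r : ℝ := ‖z₀‖ + 1 with hr
  have hr0 : 0 < r := by positivity
  have hne : ((r + 1 : ℝ) : ℂ) ≠ 0 := by
    exact_mod_cast (by positivity : r + 1 ≠ 0)
  -- Boundedness of the terms at radius `r + 1` gives a geometric majorant on the ball of radius
  -- `r`.
  obtain ⟨C, hC⟩ := (hA _ hne).tendsto_atTop_zero.norm.bddAbove_range
  have hbound : ∀ k, ‖A k‖ * (r + 1) ^ k ≤ C := fun k => by
    have := hC ⟨k, rfl⟩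
    simp only [norm_smul, norm_pow, Complex.norm_real, Real.norm_eq_abs] at this
    rwa [abs_of_pos (by positivity), mul_comm] at this
  have hq : r / (r + 1) < 1 := by rw [div_lt_one (by positivity)]; linarith
  have hd : DifferentiableOn ℂ (fun z : ℂ => ∑' k : ℕ, z ^ k • A k) (Metric.ball 0 r) := by
    refine Complex.differentiableOn_tsum_of_summable_norm (u := fun k => C * (r / (r + 1)) ^ k)
      ((summable_geometric_of_lt_one (by positivity) hq).mul_left C)
      (fun k => by fun_prop) Metric.isOpen_ball fun k z hz => ?_
    rw [mem_ball_zero_iff] at hz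
    calc ‖z ^ k • A k‖ = ‖z‖ ^ k * ‖A k‖ := by rw [norm_smul, norm_pow]
      _ ≤ r ^ k * ‖A k‖ := by gcongr
      _ = ‖A k‖ * (r + 1) ^ k * (r / (r + 1)) ^ k := by
        rw [div_pow]; field_simp
      _ ≤ C * (r / (r + 1)) ^ k := by gcongr; exact hbound k
  exact hd.differentiableAt (Metric.isOpen_ball.mem_nhds (by simp [hr]))

/-- A `2πi`-periodic function factors through the exponential. -/
theorem Function.Periodic.eq_of_exp_eq {E : Type*} {F : ℂ → E}
    (hF : Function.Periodic F (2 * Real.pi * Complex.I)) {s t : ℂ}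
    (h : Complex.exp s = Complex.exp t) : F s = F t := by
  obtain ⟨n, rfl⟩ := Complex.exp_eq_exp_iff_exists_int.1 h
  exact hF.int_mul n t

open Filter in
/-- An entire `2πi`-periodic function which is bounded on the left half-plane is an entire function
of the exponential. -/
theorem Function.Periodic.exists_differentiable_comp_exp {E : Type*} [NormedAddCommGroup E]
    [NormedSpace ℂ E] [CompleteSpace E] {F : ℂ → E}
    (hF : Function.Periodic F (2 * Real.pi * Complex.I)) (hd : Differentiable ℂ F) {C : ℝ}
    (hC : ∀ t : ℂ, t.re ≤ 0 → ‖F t‖ ≤ C) :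
    ∃ U : ℂ → E, Differentiable ℂ U ∧ ∀ t, U (Complex.exp t) = F t := by
  have hlog : ∀ z : ℂ, z ≠ 0 → DifferentiableAt ℂ (fun z => F (Complex.log z)) z := by
    intro z₀ hz₀
    -- Periodicity allows a branch of the logarithm that is holomorphic near `z₀`, even on the cut.
    have heq : (fun z => F (Complex.log z)) =ᶠ[nhds z₀]
        fun z => F (Complex.log (z / z₀) + Complex.log z₀) := by
      filter_upwards [isOpen_ne.mem_nhds hz₀] with z hz
      refine hF.eq_of_exp_eq ?_
      rw [Complex.exp_add, Complex.exp_log hz, Complex.exp_log hz₀,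
        Complex.exp_log (div_ne_zero hz hz₀), div_mul_cancel₀ _ hz₀]
    refine DifferentiableAt.congr_of_eventuallyEq ?_ heq
    refine (hd _).comp z₀ (DifferentiableAt.add_const _ ?_)
    exact (differentiableAt_id.div_const z₀).clog (by simp [div_self hz₀])
  have hbdd : BddAbove (norm ∘ (fun z => F (Complex.log z)) '' (Metric.ball (0 : ℂ) 1 \ {0})) := by
    refine ⟨C, ?_⟩
    rintro _ ⟨z, ⟨hz, hz0⟩, rfl⟩
    refine hC _ ?_
    rw [Complex.log_re]
    exact Real.log_nonpos (norm_nonneg z) (mem_ball_zero_iff.1 hz).le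
  -- Riemann's removable singularity theorem at `z = 0`.
  have h0 := Complex.differentiableOn_update_limUnder_of_bddAbove
    (Metric.ball_mem_nhds (0 : ℂ) one_pos)
    (fun z hz => (hlog z hz.2).differentiableWithinAt) hbdd
  refine ⟨Function.update (fun z => F (Complex.log z)) 0
    (limUnder (nhdsWithin 0 {0}ᶜ) fun z => F (Complex.log z)), fun z => ?_, fun t => ?_⟩
  · rcases eq_or_ne z 0 with rfl | hz
    · exact h0.differentiableAt (Metric.ball_mem_nhds _ one_pos)
    · refine (hlog z hz).congr_of_eventuallyEq ?_
      filter_upwards [isOpen_ne.mem_nhds hz] with y hy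
      rw [Function.update_of_ne hy]
  · rw [Function.update_of_ne (Complex.exp_ne_zero t)]
    exact hF.eq_of_exp_eq (Complex.exp_log (Complex.exp_ne_zero t))

/-- A `2πi`-periodic function whose logarithmic derivative is bounded by `K` on the left half-plane
grows there at most like `exp (-K Re t)`. -/
theorem Function.Periodic.exists_norm_le_mul_exp {E : Type*} [NormedAddCommGroup E]
    [NormedSpace ℂ E] {F F' : ℂ → E}
    (hF : Function.Periodic F (2 * Real.pi * Complex.I)) (hd : ∀ t, HasDerivAt F (F' t) t) {K : ℝ}
    (hK : ∀ t : ℂ, t.re ≤ 0 → ‖F' t‖ ≤ K * ‖F t‖) :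
    ∃ C, ∀ t : ℂ, t.re ≤ 0 → ‖F t‖ ≤ C * Real.exp (-(K * t.re)) := by
  have hcont : Continuous F := continuous_iff_continuousAt.2 fun t => (hd t).continuousAt
  have hper : Function.Periodic (fun y : ℝ => F (y * Complex.I)) (2 * Real.pi) := fun y => by
    simp only
    rw [← hF (y * Complex.I)]
    push_cast
    ring_nf
  obtain ⟨C, hC⟩ := (isCompact_Icc (a := (0 : ℝ)) (b := 2 * Real.pi)).exists_bound_of_continuousOn
    (f := fun y : ℝ => F (y * Complex.I)) (by fun_prop)
  have hC' : ∀ y : ℝ, ‖F (y * Complex.I)‖ ≤ C := fun y => by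
    obtain ⟨y', hy', h⟩ := hper.exists_mem_Ico₀ Real.two_pi_pos y
    rw [h]
    exact hC y' ⟨hy'.1, hy'.2.le⟩
  refine ⟨C, fun t ht => ?_⟩
  -- Gronwall runs leftward along the horizontal ray from the imaginary axis, where `C` bounds `F`.
  have hder : ∀ x : ℝ, HasDerivAt (fun x : ℝ => F (t.im * Complex.I - x))
      (-F' (t.im * Complex.I - x)) x := fun x => by
    have h1 : HasDerivAt (fun x : ℝ => (t.im * Complex.I - x : ℂ)) (-1) x :=
      (Complex.ofRealCLM.hasDerivAt (x := x)).const_sub _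
    simpa [Function.comp_def] using (hd _).scomp x h1
  have hg := norm_le_gronwallBound_of_norm_deriv_right_le (δ := C) (K := K) (ε := 0)
    (a := 0) (b := -t.re) (f := fun x : ℝ => F (t.im * Complex.I - x))
    (fun x _ => (hder x).continuousAt.continuousWithinAt)
    (fun x _ => (hder x).hasDerivWithinAt) (by simpa using hC' t.im)
    (fun x hx => by
      rw [norm_neg, add_zero]
      exact hK _ (by simpa using hx.1)) (-t.re) ⟨by linarith, le_rfl⟩
  have ht' : (t.im * Complex.I - ((-t.re : ℝ) : ℂ)) = t := by
    push_cast; rw [sub_neg_eq_add, add_comm]; exact Complex.re_add_im t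
  rw [ht', gronwallBound_ε0, sub_zero] at hg
  simpa using hg

/-! ### Iterated derivatives at a regular singular point. -/

section RegularSingular

variable {𝔸 : Type*} [NormedRing 𝔸] [NormedAlgebra ℂ 𝔸]

open Polynomial in
/-- If `z H' = H (c - B)` with `H`, `B` entire, then `z ^ n H⁽ⁿ⁾ = H F` with `F` entire and
`F(0) = ∏_{k < n} (c - k - B(0))`. -/
theorem exists_pow_smul_iteratedDeriv_eq_mul [CompleteSpace 𝔸] {H B : ℂ → 𝔸} {c : ℂ}
    (hH : Differentiable ℂ H) (hB : Differentiable ℂ B)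
    (hODE : ∀ z, z • deriv H z = H z * (algebraMap ℂ 𝔸 c - B z)) (n : ℕ) :
    ∃ F : ℂ → 𝔸, Differentiable ℂ F ∧
      F 0 = aeval (B 0) (∏ k ∈ Finset.range n, (C (c - k) - X)) ∧
      ∀ z, z ^ n • iteratedDeriv n H z = H z * F z := by
  induction n with
  | zero => exact ⟨fun _ => 1, by fun_prop, by simp, by simp⟩
  | succ n ih =>
    obtain ⟨F, hF, hF0, hFH⟩ := ih
    -- The recursion comes from differentiating `z^n H⁽ⁿ⁾ = H F`, multiplying by `z` and
    -- substituting the equation for `H`.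
    refine ⟨fun z => (algebraMap ℂ 𝔸 (c - n) - B z) * F z + z • deriv F z, ?_, ?_, fun z => ?_⟩
    · have := hF.deriv
      fun_prop
    · simp only [zero_smul, add_zero]
      rw [Finset.prod_range_succ, mul_comm, map_mul, ← hF0]
      simp
    · have hHn : Differentiable ℂ (iteratedDeriv n H) :=
        hH.contDiff.differentiable_iteratedDeriv n (WithTop.coe_lt_top _)
      have h1 : HasDerivAt (fun z => z ^ n • iteratedDeriv n H z)
          (z ^ n • iteratedDeriv (n + 1) H z + (n * z ^ (n - 1)) • iteratedDeriv n H z) z := by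
        have := (hasDerivAt_pow n z).smul (hHn z).hasDerivAt
        rwa [← iteratedDeriv_succ] at this
      have h2 : HasDerivAt (fun z => z ^ n • iteratedDeriv n H z)
          (deriv H z * F z + H z * deriv F z) z := by
        rw [funext hFH]
        exact (hH z).hasDerivAt.mul (hF z).hasDerivAt
      have h3 := congrArg (z • ·) (h1.unique h2)
      simp only [smul_add, smul_smul] at h3
      have h4 : z * (n * z ^ (n - 1)) = n * z ^ n := by
        cases n with
        | zero => simp
        | succ n => simp [pow_succ]; ring
      rw [← pow_succ', h4, mul_smul, hFH z, ← smul_mul_assoc z (deriv H z),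
        hODE, ← mul_smul_comm z (H z)] at h3
      rw [eq_sub_of_add_eq h3]
      rw [map_sub, Algebra.smul_def (n : ℂ), mul_add, ← mul_assoc (algebraMap ℂ 𝔸 n),
        Algebra.commutes (n : ℂ) (H z)]
      noncomm_ring

end RegularSingular

/-! ### Systems with trivial monodromy. -/

section FundamentalSolution

variable {𝔸 : Type*} [NormedRing 𝔸] [NormedAlgebra ℂ 𝔸] [CompleteSpace 𝔸]

/-- The inverse of an invertible solution of `S' = A S` solves `T' = -T A`. -/
theorem HasDerivAt.ringInverse_of_mul {S : ℂ → 𝔸} {a : 𝔸} {t : ℂ}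
    (hS : HasDerivAt S (a * S t) t) (hu : IsUnit (S t)) :
    HasDerivAt (fun s => Ring.inverse (S s)) (-(Ring.inverse (S t) * a)) t := by
  obtain ⟨u, hu⟩ := hu
  have h := (hasFDerivAt_ringInverse (𝕜 := ℂ) u)
  rw [hu] at h
  refine (h.comp_hasDerivAt t hS).congr_deriv ?_
  simp [← hu, mul_assoc]

/-- Two invertible solutions of the same linear equation that agree at one point are equal. -/
theorem eq_of_hasDerivAt_mul {S T A : ℂ → 𝔸} (hS : ∀ t, HasDerivAt S (A t * S t) t)
    (hT : ∀ t, HasDerivAt T (A t * T t) t) (hu : ∀ t, IsUnit (S t)) {t₀ : ℂ}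
    (h₀ : T t₀ = S t₀) : T = S := by
  have hder : ∀ t, HasDerivAt (fun s => Ring.inverse (S s) * T s) 0 t := fun t => by
    refine (((hS t).ringInverse_of_mul (hu t)).mul (hT t)).congr_deriv ?_
    noncomm_ring
  funext t
  have h := is_const_of_deriv_eq_zero (fun t => (hder t).differentiableAt)
    (fun t => (hder t).deriv) t t₀
  simp only [h₀, Ring.inverse_mul_cancel _ (hu t₀)] at h
  rw [← Ring.mul_inverse_cancel_left (S t) (T t) (hu t), h, mul_one]

open Polynomial in
/-- A regular singular system `z dS/dz = B(z) S` with trivial monodromy: the residue `B(0)` is a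
root of a product of distinct linear factors with integer roots. -/
theorem exists_aeval_prod_eq_zero_of_periodic {S B : ℂ → 𝔸} (hB : Differentiable ℂ B)
    (hS : ∀ t, HasDerivAt S (B (Complex.exp t) * S t) t) (hu : ∀ t, IsUnit (S t))
    (hper : Function.Periodic S (2 * Real.pi * Complex.I)) :
    ∃ m n : ℕ, aeval (B 0) (∏ k ∈ Finset.range n, (C ((m : ℂ) - k) - X)) = 0 := by
  set T : ℂ → 𝔸 := fun t => Ring.inverse (S t) with hT_def
  have hT : ∀ t, HasDerivAt T (-(T t * B (Complex.exp t))) t := fun t =>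
    (hS t).ringInverse_of_mul (hu t)
  have hTper : Function.Periodic T (2 * Real.pi * Complex.I) := fun t => by
    simp only [hT_def, hper t]
  obtain ⟨K, hK⟩ := (isCompact_closedBall (0 : ℂ) 1).exists_bound_of_continuousOn
    hB.continuous.continuousOn
  have hK' : ∀ t : ℂ, t.re ≤ 0 → ‖B (Complex.exp t)‖ ≤ K := fun t ht =>
    hK _ (by rw [mem_closedBall_zero_iff, Complex.norm_exp]; exact Real.exp_le_one_iff.2 ht)
  obtain ⟨m, hm⟩ := exists_nat_ge K
  -- Since `m ≥ K`, the factor `z^m` absorbs the growth `exp (-K Re t)`; this serves both `S` and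
  -- its inverse.
  have hext : ∀ {F F' : ℂ → 𝔸}, Function.Periodic F (2 * Real.pi * Complex.I) →
      (∀ t, HasDerivAt F (F' t) t) → (∀ t : ℂ, t.re ≤ 0 → ‖F' t‖ ≤ K * ‖F t‖) →
      ∃ U : ℂ → 𝔸, Differentiable ℂ U ∧
        ∀ t, U (Complex.exp t) = Complex.exp t ^ m • F t := by
    intro F F' hF hd hb
    obtain ⟨D, hD⟩ := hF.exists_norm_le_mul_exp hd hb
    refine Function.Periodic.exists_differentiable_comp_exp (C := |D|) (fun t => ?_)
      (fun t => ?_) fun t ht => ?_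
    · simp only [Complex.exp_periodic t, hF t]
    · exact (Complex.differentiable_exp.pow m t).smul (hd t).differentiableAt
    · have h1 : Real.exp (m * t.re) * Real.exp (-(K * t.re)) ≤ 1 := by
        rw [← Real.exp_add, Real.exp_le_one_iff]
        nlinarith
      calc ‖Complex.exp t ^ m • F t‖ = Real.exp (m * t.re) * ‖F t‖ := by
            rw [norm_smul, norm_pow, Complex.norm_exp, ← Real.exp_nat_mul]
        _ ≤ Real.exp (m * t.re) * (|D| * Real.exp (-(K * t.re))) := by
            gcongr
            exact (hD t ht).trans (by gcongr; exact le_abs_self D)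
        _ = |D| * (Real.exp (m * t.re) * Real.exp (-(K * t.re))) := by ring
        _ ≤ |D| := mul_le_of_le_one_right (abs_nonneg D) h1
  obtain ⟨U, hUd, hU⟩ := hext hper hS fun t ht =>
    (norm_mul_le _ _).trans (by gcongr; exact hK' t ht)
  obtain ⟨H, hHd, hH⟩ := hext hTper hT fun t ht => by
    rw [norm_neg, mul_comm K]
    exact (norm_mul_le _ _).trans (by gcongr; exact hK' t ht)
  have hODE_exp : ∀ t, Complex.exp t • deriv H (Complex.exp t) =
      H (Complex.exp t) * (algebraMap ℂ 𝔸 m - B (Complex.exp t)) := fun t => by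
    have h1 : HasDerivAt (fun t => H (Complex.exp t))
        (Complex.exp t • deriv H (Complex.exp t)) t :=
      (hHd _).hasDerivAt.scomp t (Complex.hasDerivAt_exp t)
    have h2 := ((Complex.hasDerivAt_exp t).pow m).smul (hT t)
    rw [funext hH] at h1
    have h3 : (m : ℂ) * Complex.exp t ^ (m - 1) * Complex.exp t = Complex.exp t ^ m * m := by
      cases m with
      | zero => simp
      | succ m => simp only [Nat.add_sub_cancel, pow_succ]; ring
    rw [h1.unique h2, hH t, h3, mul_smul, Pi.pow_apply, ← smul_add, smul_mul_assoc,
      Algebra.smul_def (m : ℂ), Algebra.commutes, mul_sub, neg_add_eq_sub]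
  have hODE : ∀ z, z • deriv H z = H z * (algebraMap ℂ 𝔸 m - B z) := by
    have hH' := hHd.deriv.continuous
    have hHc := hHd.continuous
    have hBc := hB.continuous
    refine congrFun (Continuous.ext_on (dense_compl_singleton (0 : ℂ)) (by fun_prop)
      (by fun_prop) fun z hz => ?_)
    simpa [Complex.exp_log hz] using hODE_exp (Complex.log z)
  -- One more than the exponent in `U H = z^(2m)`, which leaves a factor `z` in `F`.
  refine ⟨m, 2 * m + 1, ?_⟩
  obtain ⟨F, hFd, hF0, hF⟩ := exists_pow_smul_iteratedDeriv_eq_mul hHd hB hODE (2 * m + 1)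
  rw [← hF0]
  have hFz : F = fun z => z • (U z * iteratedDeriv (2 * m + 1) H z) := by
    have hUc := hUd.continuous
    have hHn := (hHd.contDiff (n := ⊤)).continuous_iteratedDeriv (2 * m + 1) le_top
    refine Continuous.ext_on (dense_compl_singleton (0 : ℂ)) hFd.continuous (by fun_prop)
      fun z hz => ?_
    have hz0 : z ^ (2 * m) ≠ 0 := pow_ne_zero _ hz
    have hUH : U z * H z = z ^ (2 * m) • (1 : 𝔸) := by
      have h1 := hU (Complex.log z)
      have h2 := hH (Complex.log z)
      rw [Complex.exp_log hz] at h1 h2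
      rw [h1, h2, smul_mul_smul_comm, Ring.mul_inverse_cancel _ (hu _), ← pow_add, two_mul]
    have h := congrArg (U z * ·) (hF z)
    simp only [mul_smul_comm, ← mul_assoc, hUH, smul_one_mul] at h
    rw [pow_succ, mul_smul] at h
    exact (smul_right_injective 𝔸 hz0 h).symm
  rw [hFz]
  exact zero_smul ℂ _

end FundamentalSolution

/-! ### Linear algebra of the residue. -/

/-- A matrix that is a root of a product of distinct linear factors with integer roots is
diagonalizable with integer eigenvalues. -/
theorem isDiagonalizableWithIntegerEigenvalues_of_aeval_eq_zero {N : ℕ}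
    {R : Matrix (Fin N) (Fin N) ℂ} {s : Finset ℤ}
    (h : Polynomial.aeval R (∏ k ∈ s, (Polynomial.X - Polynomial.C (k : ℂ))) = 0) :
    IsDiagonalizableWithIntegerEigenvalues R := by
  set p : Polynomial ℂ := ∏ k ∈ s, (Polynomial.X - Polynomial.C (k : ℂ)) with hp
  set f : Module.End ℂ (Fin N → ℂ) := Matrix.toLinAlgEquiv' R with hf
  have hfp : Polynomial.aeval f p = 0 := by
    rw [hf, Polynomial.aeval_algHom_apply, h, map_zero]
  -- Simple roots make `f` semisimple, so its eigenvectors span and a basis can be chosen among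
  -- them.
  have hsq : Squarefree p :=
    (Polynomial.separable_prod_X_sub_C_iff'.2 fun _ _ _ _ h => Int.cast_injective h).squarefree
  have hss : f.IsSemisimple := Module.End.isSemisimple_of_squarefree_aeval_eq_zero hsq hfp
  have htop : ⨆ μ : ℂ, f.eigenspace μ = ⊤ :=
    hss.iSup_maxGenEigenspace_eq_top_iff.1 (Module.End.iSup_maxGenEigenspace_eq_top f)
  have hspan : ⊤ ≤ Submodule.span ℂ {v : Fin N → ℂ | ∃ μ : ℂ, f.HasEigenvector μ v} := by
    rw [← htop, iSup_le_iff]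
    intro μ v hv
    rcases eq_or_ne v 0 with rfl | hv0
    · exact zero_mem _
    · exact Submodule.subset_span ⟨μ, hv, hv0⟩
  let b₀ := Module.Basis.ofSpan hspan
  have : Finite _ := Module.Finite.finite_basis b₀
  let e := b₀.indexEquiv (Pi.basisFun ℂ (Fin N))
  let b := b₀.reindex e
  have hb : ∀ i, ∃ l : ℤ, f (b i) = (l : ℂ) • b i := fun i => by
    obtain ⟨μ, hμ⟩ : ∃ μ : ℂ, f.HasEigenvector μ (b i) :=
      Module.Basis.ofSpan_subset hspan ⟨e.symm i, by simp [b, b₀]⟩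
    have h0 : p.eval μ • b i = 0 := by
      rw [← Module.End.aeval_apply_of_hasEigenvector hμ, hfp, LinearMap.zero_apply]
    have h1 : p.eval μ = 0 := (smul_eq_zero.1 h0).resolve_right hμ.2
    rw [hp, Polynomial.eval_prod, Finset.prod_eq_zero_iff] at h1
    obtain ⟨l, -, hl⟩ := h1
    refine ⟨l, ?_⟩
    rw [hμ.apply_eq_smul]
    congr 1
    simpa [sub_eq_zero] using hl
  choose l hl using hb
  set c := Pi.basisFun ℂ (Fin N)
  have hR : R * c.toMatrix b = c.toMatrix b * Matrix.diagonal (fun i => (l i : ℂ)) := by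
    ext i j
    have := congrFun (hl j) i
    rw [Matrix.mul_diagonal]
    simpa [hf, Matrix.mul_apply, c, Module.Basis.toMatrix_apply, Matrix.mulVec, dotProduct,
      mul_comm] using this
  refine ⟨⟨c.toMatrix b, b.toMatrix c, c.toMatrix_mul_toMatrix_flip b,
    b.toMatrix_mul_toMatrix_flip c⟩, l, ?_⟩
  change R = c.toMatrix b * _ * b.toMatrix c
  rw [← hR, mul_assoc, c.toMatrix_mul_toMatrix_flip b, mul_one]

/-! ### From the weight on the circle to the monodromy. -/

open Filter Topology in
/-- If a branch on the circle of a continuous multivalued function is continuous, then the function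
takes equal values at the two ends of the cut. -/
theorem exists_eq_of_isBranchOnCircle {N : ℕ} {w : Circle → Matrix (Fin N) (Fin N) ℂ}
    {S : ℂ → Matrix (Fin N) (Fin N) ℂ} (hwS : IsBranchOnCircle w S) (hw : Continuous w)
    (hS : Continuous S) :
    ∃ t : ℂ, S (t + 2 * Real.pi * Complex.I) = S t := by
  obtain ⟨θ₀, h⟩ := hwS
  have hlt : θ₀ < θ₀ + 2 * Real.pi := by linarith [Real.two_pi_pos]
  have hcw : Continuous fun θ : ℝ => w (Circle.exp θ) := by fun_prop
  have hcS : Continuous fun θ : ℝ => S (θ * Complex.I) := by fun_prop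
  have hcl : Set.EqOn (fun θ : ℝ => w (Circle.exp θ)) (fun θ : ℝ => S (θ * Complex.I))
      (Set.Icc θ₀ (θ₀ + 2 * Real.pi)) := by
    rw [← closure_Ioo hlt.ne]
    exact Set.EqOn.closure h hcw hcS
  refine ⟨θ₀ * Complex.I, ?_⟩
  have h1 := hcl (Set.left_mem_Icc.2 hlt.le)
  have h2 := hcl (Set.right_mem_Icc.2 hlt.le)
  simp only at h1 h2
  -- Both ends of the closed interval are the same point of the circle.
  rw [Circle.periodic_exp θ₀, h1] at h2
  rw [h2]
  push_cast
  ring_nf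

attribute [local instance] Matrix.linftyOpNormedRing Matrix.linftyOpNormedAlgebra

theorem mainTheorem12 (N : ℕ) (W : ℂ → Matrix (Fin N) (Fin N) ℂ)
    (R : Matrix (Fin N) (Fin N) ℂ) (hW : IsFuchsian W R)
    (S : ℂ → Matrix (Fin N) (Fin N) ℂ) (hS : IsFundamentalSolution W S)
    (w : Circle → Matrix (Fin N) (Fin N) ℂ) (hwS : IsBranchOnCircle w S)
    (hw : IsHolderMatrix w) :
    IsDiagonalizableWithIntegerEigenvalues R := by
  obtain ⟨-, A, hA⟩ := hW
  obtain ⟨hSd, hSu⟩ := hS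
  have hwc : Continuous w := continuous_matrix fun i j => by
    obtain ⟨M, α, hα, -, h⟩ := hw i j
    exact h.continuous hα
  -- `B` is `z W(z)` with the pole removed; its value at `0` is independent of `W 0`.
  set B : ℂ → Matrix (Fin N) (Fin N) ℂ := fun z => z • (∑' k : ℕ, z ^ k • A k) + R with hB
  have hBd : Differentiable ℂ B := by
    have := differentiable_tsum_pow_smul fun z hz => (hA z hz).summable
    fun_prop
  have hB0 : B 0 = R := by simp [hB]
  have hSd' : ∀ t, HasDerivAt S (B (Complex.exp t) * S t) t := fun t => by
    have h1 : B (Complex.exp t) * S t = Complex.exp t • (W (Complex.exp t) * S t) := by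
      have h0 := Complex.exp_ne_zero t
      simp only [hB]
      rw [(hA _ h0).tsum_eq, smul_sub, smul_smul, mul_inv_cancel₀ h0, one_smul, sub_add_cancel,
        smul_mul_assoc]
    rw [h1]
    exact hasDerivAt_pi.2 fun i => hasDerivAt_pi.2 fun j => hSd t i j
  have hSc : Continuous S := continuous_iff_continuousAt.2 fun t => (hSd' t).continuousAt
  obtain ⟨t₀, ht₀⟩ := exists_eq_of_isBranchOnCircle hwS hwc hSc
  have hper : Function.Periodic S (2 * Real.pi * Complex.I) := by
    -- The translate of `S` solves the same system and agrees with `S` at `t₀`.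
    refine congrFun (eq_of_hasDerivAt_mul (T := fun t => S (t + 2 * Real.pi * Complex.I)) hSd'
      (fun t => ?_) hSu ht₀)
    have := (hSd' (t + 2 * Real.pi * Complex.I)).comp_add_const t (2 * Real.pi * Complex.I)
    rwa [Complex.exp_periodic t] at this
  obtain ⟨m, n, h⟩ := exists_aeval_prod_eq_zero_of_periodic hBd hSd' hSu hper
  rw [hB0] at h
  refine isDiagonalizableWithIntegerEigenvalues_of_aeval_eq_zero
    (s := (Finset.range n).image fun k : ℕ => (m : ℤ) - k) ?_
  rw [Finset.prod_image (by intro i _ j _ h; simpa using h)]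
  have hneg : ∀ k ∈ Finset.range n, (Polynomial.X - Polynomial.C ((((m : ℤ) - k : ℤ)) : ℂ)) =
      -1 * (Polynomial.C ((m : ℂ) - k) - Polynomial.X) := fun k _ => by push_cast; ring
  rw [Finset.prod_congr rfl hneg, Finset.prod_mul_distrib, map_mul, h, mul_zero]
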